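/- Let $n>m\ge 1$ be integers, let $A$ be an $n\times m$ random matrix with i.i.d. standard normal entries, let $\lambda = 1-\frac{m}{n}\in(0,1)$, and let $s_{\max}(A)$ denote the largest singular value of $A$. Then for every $\alpha>0$, $$\mathbb{P}\left(s_{\max}(A)\ge r(\alpha,\lambda)\sqrt{m}\right)\le e^{-\alpha m},\qquad\text{where}\quad r(\alpha,\lambda)=(1-\lambda)^{-\frac12}+1+\sqrt{2\alpha}.$$ -/

import Mathlib

open MeasureTheory ProbabilityTheory

/-- `A` is an `n × m` random matrix whose entries are independent standard normal variables. -/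
structure IsGaussianMatrix {Ω : Type*} [MeasurableSpace Ω] (μ : Measure Ω) {n m : ℕ}
    (A : Ω → Matrix (Fin n) (Fin m) ℝ) : Prop where
  /-- every entry is a (measurable) random variable with law `N(0, 1)` -/
  hasLaw : ∀ i j, HasLaw (fun ω => A ω i j) (gaussianReal 0 1) μ
  /-- the `n * m` entries are mutually independent -/
  indep : iIndepFun (fun (p : Fin n × Fin m) (ω : Ω) => A ω p.1 p.2) μ

/-- The largest singular value of a real matrix, seen as a map between Euclidean spaces:
Mathlib lists the singular values in decreasing order, starting with index `0`. -/
noncomputable def sMax {n m : ℕ} (A : Matrix (Fin n) (Fin m) ℝ) : ℝ :=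
  (Matrix.toEuclideanLin A).singularValues 0

/-- The redundancy rate `1 - m / n` (a real number) of an `n × m` matrix. -/
noncomputable def redundancyRate (n m : ℕ) : ℝ := 1 - (m : ℝ) / (n : ℝ)

/-- `r(α, λ) = (1 - λ)^(-1/2) + 1 + √(2α)`. -/
noncomputable def rBound (α lam : ℝ) : ℝ :=
  (1 - lam) ^ (-(1 / 2) : ℝ) + 1 + √(2 * α)

open MeasureTheory ProbabilityTheory

/-! Put `θ = √(2αm)`. The threshold equals `√n + √m + θ`, so a Chernoff bound at parameter `θ`
suffices once `E exp (θ s_max) ≤ exp (θ²/2 + θ(√n + √m))` is available in a form restricted to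
finite sets of unit vectors.

The largest singular value is the supremum of `X (v, u) = ⟨v, A u⟩` over pairs of unit vectors.
Compare it with `Y (v, u) = ⟨v, g⟩ + ⟨u, h⟩`, where `g`, `h` are independent standard Gaussian
vectors. If `z` is an independent standard normal variable, `X + z` and `Y` have the same variances
and `X + z` has the larger covariances, so Slepian's inequality bounds the exponential moment of the
maximum of `X + z` by that of `Y`. The variable `z` contributes the factor `exp (θ²/2)`, while `E
exp (θ(‖g‖ + ‖h‖)) ≤ exp (θ² + θ(√n + √m))`; dividing leaves the sharp `θ²/2`, with no separate
concentration inequality.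

Slepian's inequality is proved for the soft maximum `(∑ exp (β x_t)) ^ q` with `q β = θ`, by
Gaussian interpolation (`integral_expSoftMax_comparison`). The loss `|T| ^ q` disappears as `q → 0`,
so the tail bound does not depend on the finite set `T`, and a countable dense set of pairs recovers
the spheres. -/

/-- The standard Gaussian measure on `κ → ℝ`: the product of the laws `N(0, 1)`. -/
noncomputable abbrev gaussianPi (κ : Type*) [Fintype κ] : Measure (κ → ℝ) :=
  Measure.pi fun _ => gaussianReal 0 1

/-! ### Gaussian integration by parts and integrability. -/

/-- Gaussian integration by parts on the line. -/
theorem integral_id_mul_gaussianReal_eq {f f' : ℝ → ℝ} (hf : ∀ x, HasDerivAt f (f' x) x)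
    (h₀ : Integrable f (gaussianReal 0 1)) (h₁ : Integrable (fun x => x * f x) (gaussianReal 0 1))
    (h₂ : Integrable f' (gaussianReal 0 1)) :
    ∫ x, x * f x ∂gaussianReal 0 1 = ∫ x, f' x ∂gaussianReal 0 1 := by
  have key : ∀ {g : ℝ → ℝ}, Integrable g (gaussianReal 0 1) →
      Integrable (fun x => gaussianPDFReal 0 1 x * g x) := by
    intro g hg
    rw [gaussianReal_of_var_ne_zero 0 one_ne_zero,
      integrable_withDensity_iff_integrable_smul' (measurable_gaussianPDF 0 1)
        (Filter.Eventually.of_forall fun _ => gaussianPDF_lt_top)] at hg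
    simpa [toReal_gaussianPDF] using hg
  have hd : ∀ x, HasDerivAt (gaussianPDFReal 0 1) (-(x * gaussianPDFReal 0 1 x)) x := by
    intro x
    rw [gaussianPDFReal_def]
    have h := (((hasDerivAt_pow 2 x).neg.div_const 2).exp).const_mul (√(2 * Real.pi * 1))⁻¹
    refine (h.congr_deriv ?_).congr_of_eventuallyEq (Filter.Eventually.of_forall fun y => ?_)
    · simp; ring
    · simp
  rw [integral_gaussianReal_eq_integral_smul one_ne_zero,
    integral_gaussianReal_eq_integral_smul one_ne_zero]
  -- The Gaussian density `p` satisfies `p' = -x p`, so ordinary integration by parts turns `x f p`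
  -- into `f' p`.
  have := integral_mul_deriv_eq_deriv_mul_of_integrable (u := gaussianPDFReal 0 1) (v := f)
    (u' := fun x => -(x * gaussianPDFReal 0 1 x)) (v' := f') (fun x _ => hd x) (fun x _ => hf x)
    (key h₂) ((key h₁).neg.congr (Filter.Eventually.of_forall fun x => by simp; ring)) (key h₀)
  simp only [smul_eq_mul]
  rw [this, ← integral_neg]
  exact integral_congr_ae (Filter.Eventually.of_forall fun x => by simp; ring)

section

variable {κ : Type*} [Fintype κ]

/-- Resampling one coordinate independently preserves a product probability measure. -/
theorem measurePreserving_update_pi [DecidableEq κ] (k : κ) :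
    MeasurePreserving (fun p : (κ → ℝ) × ℝ => Function.update p.1 k p.2)
      ((gaussianPi κ).prod (gaussianReal 0 1)) (gaussianPi κ) := by
  have hm : Measurable (fun p : (κ → ℝ) × ℝ => Function.update p.1 k p.2) := by
    refine measurable_pi_lambda _ fun i => ?_
    by_cases h : i = k
    · subst h; simpa using measurable_snd
    · simp only [Function.update_of_ne h]; fun_prop
  refine ⟨hm, (Measure.pi_eq fun s hs => ?_).symm⟩
  rw [Measure.map_apply hm (MeasurableSet.univ_pi hs)]
  have : (fun p : (κ → ℝ) × ℝ => Function.update p.1 k p.2) ⁻¹' Set.univ.pi s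
      = (Set.univ.pi (Function.update s k Set.univ)) ×ˢ s k := by
    ext p
    simp only [Set.mem_preimage, Set.mem_pi, Set.mem_univ, true_imp_iff, Set.mem_prod]
    constructor
    · intro h
      refine ⟨fun i => ?_, by simpa using h k⟩
      by_cases hi : i = k
      · subst hi; simp
      · simpa [hi] using h i
    · rintro ⟨h, h'⟩ i
      by_cases hi : i = k
      · subst hi; simpa using h'
      · simpa [hi] using h i
  rw [this, Measure.prod_prod, Measure.pi_pi, ← Finset.mul_prod_erase _ _ (Finset.mem_univ k),
    ← Finset.mul_prod_erase _ _ (Finset.mem_univ k)]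
  simp only [Function.update_self, measure_univ, one_mul]
  rw [mul_comm]
  congr 1
  refine Finset.prod_congr rfl fun i hi => ?_
  rw [Function.update_of_ne (Finset.ne_of_mem_erase hi)]

/-- Gaussian integration by parts in one coordinate of a standard Gaussian vector. -/
theorem integral_coord_mul_gaussianPi_eq [DecidableEq κ] (k : κ) {f f' : (κ → ℝ) → ℝ}
    (hf : ∀ x, HasDerivAt (fun y => f (Function.update x k y)) (f' x) (x k))
    (h₀ : Integrable f (gaussianPi κ)) (h₁ : Integrable (fun x => x k * f x) (gaussianPi κ))
    (h₂ : Integrable f' (gaussianPi κ)) :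
    ∫ x, x k * f x ∂gaussianPi κ = ∫ x, f' x ∂gaussianPi κ := by
  have mp := measurePreserving_update_pi k
  have hint : ∀ {g : (κ → ℝ) → ℝ}, Integrable g (gaussianPi κ) →
      Integrable (fun p : (κ → ℝ) × ℝ => g (Function.update p.1 k p.2))
        ((gaussianPi κ).prod (gaussianReal 0 1)) := fun hg => mp.integrable_comp_of_integrable hg
  have hfub : ∀ {g : (κ → ℝ) → ℝ}, Integrable g (gaussianPi κ) → ∫ x, g x ∂gaussianPi κ
      = ∫ x, ∫ y, g (Function.update x k y) ∂gaussianReal 0 1 ∂gaussianPi κ := by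
    intro g hg
    have h := integral_map (f := g) mp.aemeasurable (by rw [mp.map_eq]; exact hg.1)
    rw [mp.map_eq] at h
    rw [h]
    exact integral_prod (fun p : (κ → ℝ) × ℝ => g (Function.update p.1 k p.2)) (hint hg)
  rw [hfub h₁, hfub h₂]
  refine integral_congr_ae ?_
  filter_upwards [(hint h₀).prod_right_ae, (hint h₁).prod_right_ae, (hint h₂).prod_right_ae]
    with x i₀ i₁ i₂
  simp only [Function.update_self] at i₁ ⊢
  refine integral_id_mul_gaussianReal_eq (fun y => ?_) i₀ i₁ i₂
  simpa using hf (Function.update x k y)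

/-- The integrand factors over coordinates, and `exp (K|y|) ≤ exp (Ky) + exp (-Ky)`. It dominates
every integrand of the interpolation argument. -/
theorem integrable_exp_mul_sum_abs_gaussianPi (K : ℝ) :
    Integrable (fun x : κ → ℝ => Real.exp (K * ∑ i, |x i|)) (gaussianPi κ) := by
  have h1 : Integrable (fun y : ℝ => Real.exp (K * |y|)) (gaussianReal 0 1) := by
    refine ((integrable_exp_mul_gaussianReal (μ := 0) (v := 1) K).add
      (integrable_exp_mul_gaussianReal (μ := 0) (v := 1) (-K))).mono'
      (by fun_prop) (Filter.Eventually.of_forall fun y => ?_)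
    simp only [Real.norm_eq_abs, Real.abs_exp, Pi.add_apply]
    rcases abs_cases y with ⟨h, _⟩ | ⟨h, _⟩ <;> rw [h]
    · linarith [Real.exp_pos (-K * y)]
    · rw [mul_neg, ← neg_mul]; linarith [Real.exp_pos (K * y)]
  have := Integrable.fintype_prod (f := fun (_ : κ) (y : ℝ) => Real.exp (K * |y|))
    (μ := fun _ => gaussianReal 0 1) fun _ => h1
  simpa only [Finset.mul_sum, Real.exp_sum] using this

/-- Functions of at most exponential growth are integrable for the Gaussian measure. -/
theorem integrable_gaussianPi_of_abs_le {g : (κ → ℝ) → ℝ} (hg : Continuous g) {C K : ℝ}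
    (h : ∀ x, |g x| ≤ C * Real.exp (K * ∑ i, |x i|)) : Integrable g (gaussianPi κ) :=
  ((integrable_exp_mul_sum_abs_gaussianPi K).const_mul C).mono' hg.aestronglyMeasurable
    (Filter.Eventually.of_forall h)

end

/-! ### Exponential moments of squared normal variables. -/

/-- The exponential moments of the square of a standard normal variable. -/
theorem integral_exp_mul_sq_gaussianReal {a : ℝ} (ha : a < 1 / 2) :
    ∫ x, Real.exp (a * x ^ 2) ∂gaussianReal 0 1 = (√(1 - 2 * a))⁻¹ := by
  rw [integral_gaussianReal_eq_integral_smul one_ne_zero]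
  have : ∀ x : ℝ, gaussianPDFReal 0 1 x • Real.exp (a * x ^ 2)
      = (√(2 * Real.pi))⁻¹ * Real.exp (-(1 / 2 - a) * x ^ 2) := by
    intro x
    rw [gaussianPDFReal, smul_eq_mul, mul_assoc, ← Real.exp_add]
    congr 2
    · simp
    · simp; ring
  simp_rw [this]
  rw [integral_const_mul, integral_gaussian, ← Real.sqrt_inv, ← Real.sqrt_inv,
    ← Real.sqrt_mul (by positivity)]
  congr 1
  have : 1 - 2 * a ≠ 0 := by linarith
  have h2 : 1 / 2 - a ≠ 0 := by linarith
  field_simp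

theorem integrable_exp_mul_sq_gaussianReal {a : ℝ} (ha : a < 1 / 2) :
    Integrable (fun x => Real.exp (a * x ^ 2)) (gaussianReal 0 1) := by
  -- A nonintegrable function would have integral `0` by convention, but the computed value is
  -- positive.
  by_contra h
  have := integral_exp_mul_sq_gaussianReal ha
  rw [integral_undef h] at this
  have h2 : 0 < (√(1 - 2 * a))⁻¹ := inv_pos.2 (Real.sqrt_pos.2 (by linarith))
  linarith

/-- With `a = θ / (2 (θ + s))`, the exponential moment of `a x²` is at most `exp (θ / (2 s))`. -/
theorem integral_exp_mul_sq_gaussianReal_le {θ s : ℝ} (hθ : 0 ≤ θ) (hs : 0 < s) :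
    ∫ x, Real.exp (θ / (2 * (θ + s)) * x ^ 2) ∂gaussianReal 0 1 ≤ Real.exp (θ / (2 * s)) := by
  have hp : 0 < θ + s := by positivity
  rw [integral_exp_mul_sq_gaussianReal (by rw [div_lt_iff₀ (by positivity)]; linarith)]
  have : 1 - 2 * (θ / (2 * (θ + s))) = (θ / s + 1)⁻¹ := by field_simp; ring
  rw [this, Real.sqrt_inv, inv_inv]
  calc √(θ / s + 1) ≤ √(Real.exp (θ / s)) := Real.sqrt_le_sqrt (Real.add_one_le_exp _)
    _ = Real.exp (θ / (2 * s)) := by rw [← Real.exp_half]; congr 1; field_simp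

/-! ### Calculus of the soft maximum. -/

section SoftMax

variable {T : Type*} [Fintype T]

/-- The sum of exponentials `∑ t, exp (β x_t)`. -/
noncomputable def expSum (β : ℝ) (x : T → ℝ) : ℝ := ∑ t, Real.exp (β * x t)

/-- A smooth substitute for `exp (θ * max x)`, with `θ = q β`. -/
noncomputable def expSoftMax (β q : ℝ) (x : T → ℝ) : ℝ := expSum β x ^ q

/-- The partial derivatives of `expSoftMax`. -/
noncomputable def expSoftMaxGrad (β q : ℝ) (x : T → ℝ) (t : T) : ℝ :=
  q * β * (Real.exp (β * x t) * expSum β x ^ (q - 1))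

/-- The second partial derivatives of `expSoftMax`. -/
noncomputable def expSoftMaxHess [DecidableEq T] (β q : ℝ) (x : T → ℝ) (t s : T) : ℝ :=
  q * β ^ 2 * ((if t = s then Real.exp (β * x t) * expSum β x ^ (q - 1) else 0)
    + (q - 1) * (Real.exp (β * x t) * Real.exp (β * x s) * expSum β x ^ (q - 2)))

variable {β q : ℝ}

theorem expSum_pos [Nonempty T] (x : T → ℝ) : 0 < expSum β x :=
  Finset.sum_pos (fun _ _ => Real.exp_pos _) Finset.univ_nonempty

theorem exp_le_expSum (x : T → ℝ) (t : T) : Real.exp (β * x t) ≤ expSum β x :=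
  Finset.single_le_sum (f := fun t => Real.exp (β * x t)) (fun _ _ => (Real.exp_pos _).le)
    (Finset.mem_univ t)

theorem expSoftMax_pos [Nonempty T] (x : T → ℝ) : 0 < expSoftMax β q x :=
  Real.rpow_pos_of_pos (expSum_pos x) _

/-- Together with `expSoftMax_le`, this squeezes the soft maximum between `exp (θ max x)` and `|T| ^
q` times it, where `θ = q β`. -/
theorem exp_le_expSoftMax (hq : 0 ≤ q) (x : T → ℝ) (t : T) :
    Real.exp (q * β * x t) ≤ expSoftMax β q x := by
  calc Real.exp (q * β * x t) = Real.exp (β * x t) ^ q := by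
        rw [← Real.exp_mul]; congr 1; ring
    _ ≤ _ := Real.rpow_le_rpow (Real.exp_pos _).le (exp_le_expSum x t) hq

theorem expSoftMax_le [Nonempty T] (hβ : 0 ≤ β) (hq : 0 ≤ q) {x : T → ℝ} {M : ℝ}
    (h : ∀ t, x t ≤ M) :
    expSoftMax β q x ≤ (Fintype.card T : ℝ) ^ q * Real.exp (q * β * M) := by
  have : expSum β x ≤ Fintype.card T * Real.exp (β * M) := by
    calc expSum β x ≤ ∑ _t : T, Real.exp (β * M) :=
          Finset.sum_le_sum fun t _ =>
            Real.exp_le_exp.2 (mul_le_mul_of_nonneg_left (h t) hβ)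
      _ = _ := by simp
  refine (Real.rpow_le_rpow (expSum_pos x).le this hq).trans_eq ?_
  rw [Real.mul_rpow (by positivity) (Real.exp_pos _).le, ← Real.exp_mul]
  congr 2; ring

theorem continuous_expSum : Continuous (expSum β : (T → ℝ) → ℝ) := by
  unfold expSum; fun_prop

theorem continuous_expSum_rpow [Nonempty T] (p : ℝ) :
    Continuous (fun x : T → ℝ => expSum β x ^ p) :=
  continuous_expSum.rpow_const fun x => Or.inl (expSum_pos x).ne'

theorem continuous_expSoftMax [Nonempty T] : Continuous (expSoftMax β q : (T → ℝ) → ℝ) :=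
  continuous_expSum_rpow q

theorem continuous_expSoftMaxGrad [Nonempty T] (t : T) :
    Continuous (fun x : T → ℝ => expSoftMaxGrad β q x t) := by
  have := continuous_expSum_rpow (T := T) (β := β) (q - 1)
  unfold expSoftMaxGrad; fun_prop

theorem continuous_expSoftMaxHess [Nonempty T] [DecidableEq T] (t s : T) :
    Continuous (fun x : T → ℝ => expSoftMaxHess β q x t s) := by
  have := continuous_expSum_rpow (T := T) (β := β) (q - 1)
  have := continuous_expSum_rpow (T := T) (β := β) (q - 2)
  unfold expSoftMaxHess
  split_ifs <;> fun_prop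

section curve

variable {x : ℝ → T → ℝ} {x' : T → ℝ} {τ : ℝ}

theorem hasDerivAt_expSum (hx : ∀ t, HasDerivAt (fun τ => x τ t) (x' t) τ) :
    HasDerivAt (fun τ => expSum β (x τ)) (∑ t, β * Real.exp (β * x τ t) * x' t) τ :=
  HasDerivAt.fun_sum fun t _ => (((hx t).const_mul β).exp).congr_deriv (by ring)

theorem hasDerivAt_expSum_rpow [Nonempty T] (p : ℝ)
    (hx : ∀ t, HasDerivAt (fun τ => x τ t) (x' t) τ) :
    HasDerivAt (fun τ => expSum β (x τ) ^ p)
      (∑ t, p * β * (Real.exp (β * x τ t) * expSum β (x τ) ^ (p - 1)) * x' t) τ := by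
  refine ((hasDerivAt_expSum hx).rpow_const (p := p) (Or.inl (expSum_pos _).ne')).congr_deriv ?_
  rw [Finset.sum_mul, Finset.sum_mul]
  exact Finset.sum_congr rfl fun t _ => by ring

theorem hasDerivAt_expSoftMax [Nonempty T] (hx : ∀ t, HasDerivAt (fun τ => x τ t) (x' t) τ) :
    HasDerivAt (fun τ => expSoftMax β q (x τ)) (∑ t, expSoftMaxGrad β q (x τ) t * x' t) τ :=
  hasDerivAt_expSum_rpow q hx

theorem hasDerivAt_expSoftMaxGrad [Nonempty T] [DecidableEq T] (t : T)
    (hx : ∀ t, HasDerivAt (fun τ => x τ t) (x' t) τ) :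
    HasDerivAt (fun τ => expSoftMaxGrad β q (x τ) t)
      (∑ s, expSoftMaxHess β q (x τ) t s * x' s) τ := by
  refine (((((hx t).const_mul β).exp).mul (hasDerivAt_expSum_rpow (q - 1) hx)).const_mul
    (q * β)).congr_deriv ?_
  simp only [expSoftMaxHess, mul_add, add_mul, Finset.sum_add_distrib]
  rw [Finset.mul_sum, Finset.mul_sum]
  congr 1
  · simp; ring
  · refine Finset.sum_congr rfl fun s _ => ?_
    rw [show q - 1 - 1 = q - 2 by ring]; ring

end curve

theorem expSum_rpow_sub_one [Nonempty T] (x : T → ℝ) :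
    expSum β x * expSum β x ^ (q - 1) = expSum β x ^ q := by
  rw [Real.rpow_sub_one (expSum_pos x).ne', mul_div_cancel₀ _ (expSum_pos x).ne']

theorem expSum_rpow_sub_two [Nonempty T] (x : T → ℝ) :
    expSum β x * expSum β x * expSum β x ^ (q - 2) = expSum β x ^ q := by
  rw [← expSum_rpow_sub_one (q := q) x, ← expSum_rpow_sub_one (q := q - 1) x,
    show q - 1 - 1 = q - 2 by ring, mul_assoc]

/-- Adding a constant `s` to all coordinates multiplies the soft maximum by `exp (q β s)`; the sum
is the second derivative in that direction. -/
theorem sum_sum_expSoftMaxHess [Nonempty T] [DecidableEq T] (x : T → ℝ) :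
    ∑ t, ∑ s, expSoftMaxHess β q x t s = (q * β) ^ 2 * expSoftMax β q x := by
  have h1 : ∑ t, ∑ s, (if t = s then Real.exp (β * x t) * expSum β x ^ (q - 1) else 0)
      = expSoftMax β q x := by
    simp only [Finset.sum_ite_eq, Finset.mem_univ, if_true]
    rw [← Finset.sum_mul]; exact expSum_rpow_sub_one x
  have h2 : ∑ t, ∑ s, Real.exp (β * x t) * Real.exp (β * x s) * expSum β x ^ (q - 2)
      = expSoftMax β q x := by
    simp only [← Finset.sum_mul, ← Finset.mul_sum]
    exact expSum_rpow_sub_two x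
  simp only [expSoftMaxHess, ← Finset.mul_sum, Finset.sum_add_distrib, h1, h2]
  ring

/-- Only the term with the factor `q - 1 ≤ 0` survives off the diagonal. This sign is what drives
Slepian's inequality. -/
theorem expSoftMaxHess_nonpos_of_ne [Nonempty T] [DecidableEq T] (hq : 0 ≤ q) (hq1 : q ≤ 1)
    (x : T → ℝ) {t s : T} (hts : t ≠ s) : expSoftMaxHess β q x t s ≤ 0 := by
  have := expSum_pos (β := β) x
  simp only [expSoftMaxHess, hts, if_false, zero_add]
  refine mul_nonpos_of_nonneg_of_nonpos (by positivity)
    (mul_nonpos_of_nonpos_of_nonneg (by linarith) (by positivity))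

theorem abs_expSoftMaxGrad_le [Nonempty T] (x : T → ℝ) (t : T) :
    |expSoftMaxGrad β q x t| ≤ |q * β| * expSoftMax β q x := by
  have hp := expSum_pos (β := β) x
  rw [expSoftMaxGrad, abs_mul]
  refine mul_le_mul_of_nonneg_left ?_ (abs_nonneg _)
  rw [abs_of_nonneg (by positivity), expSoftMax, ← expSum_rpow_sub_one (q := q) x]
  exact mul_le_mul_of_nonneg_right (exp_le_expSum x t) (by positivity)

theorem abs_expSoftMaxHess_le [Nonempty T] [DecidableEq T] (x : T → ℝ) (t s : T) :
    |expSoftMaxHess β q x t s| ≤ |q * β ^ 2| * (1 + |q - 1|) * expSoftMax β q x := by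
  have hp := expSum_pos (β := β) x
  rw [expSoftMaxHess, abs_mul, mul_assoc |q * β ^ 2|]
  refine mul_le_mul_of_nonneg_left ?_ (abs_nonneg _)
  refine (abs_add_le _ _).trans ?_
  rw [add_mul, one_mul, abs_mul]
  refine add_le_add ?_ (mul_le_mul_of_nonneg_left ?_ (abs_nonneg _))
  · split_ifs
    · rw [abs_of_nonneg (by positivity), expSoftMax, ← expSum_rpow_sub_one (q := q) x]
      exact mul_le_mul_of_nonneg_right (exp_le_expSum x t) (by positivity)
    · rw [abs_zero]; exact (expSoftMax_pos x).le
  · rw [abs_of_nonneg (by positivity), expSoftMax, ← expSum_rpow_sub_two (q := q) x]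
    exact mul_le_mul_of_nonneg_right (mul_le_mul (exp_le_expSum x t) (exp_le_expSum x s)
      (Real.exp_pos _).le hp.le) (by positivity)

end SoftMax

/-! ### Gaussian interpolation and Slepian comparison. -/

section Interpolation

open Matrix

variable {T κ : Type*} [Fintype κ] {β q : ℝ}

theorem abs_mulVec_le {c : Matrix T κ ℝ} {M : ℝ} (hc : ∀ t k, |c t k| ≤ M) (ξ : κ → ℝ) (t : T) :
    |(c *ᵥ ξ) t| ≤ M * ∑ k, |ξ k| := by
  rw [Finset.mul_sum]
  refine (Finset.abs_sum_le_sum_abs _ _).trans (Finset.sum_le_sum fun k _ => ?_)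
  rw [abs_mul]
  exact mul_le_mul_of_nonneg_right (hc t k) (abs_nonneg _)

theorem continuous_mulVec (c : Matrix T κ ℝ) : Continuous fun ξ : κ → ℝ => c *ᵥ ξ :=
  Continuous.matrix_mulVec continuous_const continuous_id

variable [Fintype T]

theorem exists_abs_entry_le (c : Matrix T κ ℝ) : ∃ M, 0 ≤ M ∧ ∀ t k, |c t k| ≤ M := by
  refine ⟨∑ t, ∑ k, |c t k|, by positivity, fun t k => ?_⟩
  exact (Finset.single_le_sum (f := fun k => |c t k|) (fun _ _ => abs_nonneg _)
    (Finset.mem_univ k)).trans (Finset.single_le_sum (f := fun t => ∑ k, |c t k|)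
      (fun _ _ => by positivity) (Finset.mem_univ t))

variable [Nonempty T]

theorem expSoftMax_mulVec_le (hβ : 0 ≤ β) (hq : 0 ≤ q) {c : Matrix T κ ℝ} {M : ℝ}
    (hc : ∀ t k, |c t k| ≤ M) (ξ : κ → ℝ) :
    expSoftMax β q (c *ᵥ ξ)
      ≤ (Fintype.card T : ℝ) ^ q * Real.exp (q * β * M * ∑ k, |ξ k|) := by
  rw [mul_assoc (q * β)]
  exact expSoftMax_le hβ hq fun t => (le_abs_self _).trans (abs_mulVec_le hc ξ t)

theorem integrable_of_abs_le_expSoftMax (hβ : 0 ≤ β) (hq : 0 ≤ q) {c : Matrix T κ ℝ}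
    {g : (κ → ℝ) → ℝ} (hg : Continuous g) {C : ℝ} (hC : 0 ≤ C)
    (h : ∀ ξ, |g ξ| ≤ C * expSoftMax β q (c *ᵥ ξ)) : Integrable g (gaussianPi κ) := by
  obtain ⟨M, _, hM⟩ := exists_abs_entry_le c
  refine integrable_gaussianPi_of_abs_le hg (C := C * (Fintype.card T : ℝ) ^ q)
    (K := q * β * M) fun ξ => ?_
  rw [mul_assoc]
  exact (h ξ).trans (mul_le_mul_of_nonneg_left (expSoftMax_mulVec_le hβ hq hM ξ) hC)

theorem integrable_expSoftMax_mulVec (hβ : 0 ≤ β) (hq : 0 ≤ q) (c : Matrix T κ ℝ) :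
    Integrable (fun ξ => expSoftMax β q (c *ᵥ ξ)) (gaussianPi κ) :=
  integrable_of_abs_le_expSoftMax hβ hq (continuous_expSoftMax.comp (continuous_mulVec c))
    zero_le_one fun _ => by rw [one_mul, abs_of_pos (expSoftMax_pos _)]

theorem integrable_expSoftMaxGrad_mulVec (hβ : 0 ≤ β) (hq : 0 ≤ q) (c : Matrix T κ ℝ) (t : T) :
    Integrable (fun ξ => expSoftMaxGrad β q (c *ᵥ ξ) t) (gaussianPi κ) :=
  integrable_of_abs_le_expSoftMax hβ hq ((continuous_expSoftMaxGrad t).comp (continuous_mulVec c))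
    (abs_nonneg _) fun _ => abs_expSoftMaxGrad_le _ t

theorem integrable_expSoftMaxHess_mulVec [DecidableEq T] (hβ : 0 ≤ β) (hq : 0 ≤ q)
    (c : Matrix T κ ℝ) (t s : T) :
    Integrable (fun ξ => expSoftMaxHess β q (c *ᵥ ξ) t s) (gaussianPi κ) :=
  integrable_of_abs_le_expSoftMax hβ hq
    ((continuous_expSoftMaxHess t s).comp (continuous_mulVec c))
    (by positivity) fun _ => abs_expSoftMaxHess_le _ t s

/-- The extra `1` in the exponent absorbs the linear growth of `y`. -/
theorem abs_grad_mul_le (hβ : 0 ≤ β) (hq : 0 ≤ q) {c : Matrix T κ ℝ} {M N y : ℝ}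
    (hc : ∀ t k, |c t k| ≤ M) (ξ : κ → ℝ) (hN : 0 ≤ N) (hy : |y| ≤ N * ∑ k, |ξ k|) (t : T) :
    |expSoftMaxGrad β q (c *ᵥ ξ) t * y|
      ≤ q * β * (Fintype.card T : ℝ) ^ q * N * Real.exp ((q * β * M + 1) * ∑ k, |ξ k|) := by
  have hqb : 0 ≤ q * β := mul_nonneg hq hβ
  have h1 : |expSoftMaxGrad β q (c *ᵥ ξ) t|
      ≤ q * β * ((Fintype.card T : ℝ) ^ q * Real.exp (q * β * M * ∑ k, |ξ k|)) :=
    (abs_expSoftMaxGrad_le _ t).trans (by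
      rw [abs_of_nonneg hqb]
      exact mul_le_mul_of_nonneg_left (expSoftMax_mulVec_le hβ hq hc ξ) hqb)
  have h2 : |y| ≤ N * Real.exp (∑ k, |ξ k|) :=
    hy.trans (mul_le_mul_of_nonneg_left (by linarith [Real.add_one_le_exp (∑ k, |ξ k|)]) hN)
  rw [abs_mul]
  refine (mul_le_mul h1 h2 (abs_nonneg _) (by positivity)).trans_eq ?_
  rw [add_mul, Real.exp_add, one_mul]
  ring

theorem integrable_coord_mul_expSoftMaxGrad (hβ : 0 ≤ β) (hq : 0 ≤ q) (c : Matrix T κ ℝ)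
    (t : T) (k : κ) :
    Integrable (fun ξ => ξ k * expSoftMaxGrad β q (c *ᵥ ξ) t) (gaussianPi κ) := by
  obtain ⟨M, _, hM⟩ := exists_abs_entry_le c
  refine integrable_gaussianPi_of_abs_le
    ((continuous_apply k).mul ((continuous_expSoftMaxGrad t).comp (continuous_mulVec c)))
    (C := q * β * (Fintype.card T : ℝ) ^ q * 1) (K := q * β * M + 1) fun ξ => ?_
  rw [mul_comm (ξ k)]
  refine abs_grad_mul_le hβ hq hM ξ zero_le_one ?_ t
  rw [one_mul]
  exact Finset.single_le_sum (f := fun k => |ξ k|) (fun _ _ => abs_nonneg _) (Finset.mem_univ k)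

theorem integral_coord_mul_expSoftMaxGrad [DecidableEq T] (hβ : 0 ≤ β) (hq : 0 ≤ q)
    (c : Matrix T κ ℝ) (t : T) (k : κ) :
    ∫ ξ, ξ k * expSoftMaxGrad β q (c *ᵥ ξ) t ∂gaussianPi κ
      = ∑ s, c s k * ∫ ξ, expSoftMaxHess β q (c *ᵥ ξ) t s ∂gaussianPi κ := by
  classical
  have hi : ∀ s ∈ Finset.univ, Integrable (fun ξ => expSoftMaxHess β q (c *ᵥ ξ) t s * c s k)
      (gaussianPi κ) := fun s _ => (integrable_expSoftMaxHess_mulVec hβ hq c t s).mul_const _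
  rw [integral_coord_mul_gaussianPi_eq k
    (f' := fun ξ => ∑ s, expSoftMaxHess β q (c *ᵥ ξ) t s * c s k) (fun ξ => ?_)
    (integrable_expSoftMaxGrad_mulVec hβ hq c t)
    (integrable_coord_mul_expSoftMaxGrad hβ hq c t k) (integrable_finsetSum _ hi),
    integral_finsetSum _ hi]
  · exact Finset.sum_congr rfl fun s _ => by rw [integral_mul_const, mul_comm]
  · have := hasDerivAt_expSoftMaxGrad (β := β) (q := q)
      (x := fun y => c *ᵥ Function.update ξ k y) (x' := fun s => c s k) (τ := ξ k) t fun s => by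
        have h : ∀ j ∈ Finset.univ, HasDerivAt (fun y => c s j * Function.update ξ k y j)
            (if j = k then c s j else 0) (ξ k) := by
          intro j _
          by_cases hj : j = k
          · subst hj; simpa using (hasDerivAt_id (ξ j)).const_mul (c s j)
          · simpa [hj] using hasDerivAt_const (ξ k) (c s j * ξ j)
        have h' := HasDerivAt.fun_sum h
        simp only [Finset.sum_ite_eq', Finset.mem_univ, if_true] at h'
        exact h'
    simpa using this

/-- Integration by parts in each coordinate of `ξ` replaces the factor `d *ᵥ ξ` by its covariance
with `c *ᵥ ξ`. -/
theorem integral_grad_mul_mulVec [DecidableEq T] (hβ : 0 ≤ β) (hq : 0 ≤ q) (c d : Matrix T κ ℝ) :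
    ∫ ξ, ∑ t, expSoftMaxGrad β q (c *ᵥ ξ) t * (d *ᵥ ξ) t ∂gaussianPi κ
      = ∫ ξ, ∑ t, ∑ s, (d * cᵀ) t s * expSoftMaxHess β q (c *ᵥ ξ) t s ∂gaussianPi κ := by
  have hk : ∀ t, ∀ k ∈ Finset.univ, Integrable
      (fun ξ => d t k * (ξ k * expSoftMaxGrad β q (c *ᵥ ξ) t)) (gaussianPi κ) :=
    fun t k _ => (integrable_coord_mul_expSoftMaxGrad hβ hq c t k).const_mul _
  have hs : ∀ t, ∀ s ∈ Finset.univ, Integrable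
      (fun ξ => (d * cᵀ) t s * expSoftMaxHess β q (c *ᵥ ξ) t s) (gaussianPi κ) :=
    fun t s _ => (integrable_expSoftMaxHess_mulVec hβ hq c t s).const_mul _
  have he : ∀ t ξ, expSoftMaxGrad β q (c *ᵥ ξ) t * (d *ᵥ ξ) t
      = ∑ k, d t k * (ξ k * expSoftMaxGrad β q (c *ᵥ ξ) t) := by
    intro t ξ
    rw [Matrix.mulVec, dotProduct, Finset.mul_sum]
    exact Finset.sum_congr rfl fun k _ => by ring
  simp_rw [he]
  rw [integral_finsetSum _ fun t _ => integrable_finsetSum _ (hk t),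
    integral_finsetSum _ fun t _ => integrable_finsetSum _ (hs t)]
  refine Finset.sum_congr rfl fun t _ => ?_
  rw [integral_finsetSum _ (hk t), integral_finsetSum _ (hs t)]
  simp_rw [integral_const_mul, integral_coord_mul_expSoftMaxGrad hβ hq, Matrix.mul_apply,
    Matrix.transpose_apply, Finset.mul_sum, Finset.sum_mul]
  rw [Finset.sum_comm]
  exact Finset.sum_congr rfl fun s _ => Finset.sum_congr rfl fun k _ => by ring

/-- Differentiation of the Gaussian expectation along a rotation between two Gaussian vectors. -/
theorem hasDerivAt_integral_rotation [DecidableEq T] (hβ : 0 ≤ β) (hq : 0 ≤ q)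
    (a b : Matrix T κ ℝ) (φ : ℝ) :
    HasDerivAt (fun φ => ∫ ξ, expSoftMax β q ((Real.cos φ • a + Real.sin φ • b) *ᵥ ξ)
        ∂gaussianPi κ)
      (∫ ξ, ∑ t, ∑ s, ((-Real.sin φ • a + Real.cos φ • b) * (Real.cos φ • a + Real.sin φ • b)ᵀ) t s
        * expSoftMaxHess β q ((Real.cos φ • a + Real.sin φ • b) *ᵥ ξ) t s ∂gaussianPi κ) φ := by
  obtain ⟨A, hA0, hA⟩ := exists_abs_entry_le a
  obtain ⟨B, hB0, hB⟩ := exists_abs_entry_le b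
  -- An entry bound independent of the angle gives one dominating function for all `φ`.
  have hbd : ∀ x y : ℝ, |x| ≤ 1 → |y| ≤ 1 → ∀ t k, |(x • a + y • b) t k| ≤ A + B := by
    intro x y hx hy t k
    simp only [Matrix.add_apply, Matrix.smul_apply, smul_eq_mul]
    refine (abs_add_le _ _).trans ?_
    rw [abs_mul, abs_mul]
    nlinarith [hA t k, hB t k, abs_nonneg (a t k), abs_nonneg (b t k)]
  rw [← integral_grad_mul_mulVec hβ hq]
  have hF : ∀ x : ℝ, Continuous fun ξ =>
      expSoftMax β q ((Real.cos x • a + Real.sin x • b) *ᵥ ξ) :=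
    fun x => continuous_expSoftMax.comp (continuous_mulVec _)
  refine (hasDerivAt_integral_of_dominated_loc_of_deriv_le (μ := gaussianPi κ)
    (F := fun φ ξ => expSoftMax β q ((Real.cos φ • a + Real.sin φ • b) *ᵥ ξ))
    (F' := fun φ ξ => ∑ t, expSoftMaxGrad β q ((Real.cos φ • a + Real.sin φ • b) *ᵥ ξ) t
      * ((-Real.sin φ • a + Real.cos φ • b) *ᵥ ξ) t)
    (s := Set.univ)
    (bound := fun ξ => ∑ _t : T, q * β * (Fintype.card T : ℝ) ^ q * (A + B)
      * Real.exp ((q * β * (A + B) + 1) * ∑ k, |ξ k|)) Filter.univ_mem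
    (Filter.Eventually.of_forall fun x => (hF x).aestronglyMeasurable)
    (integrable_expSoftMax_mulVec hβ hq _) ?_
    (Filter.Eventually.of_forall fun ξ x _ => ?_)
    (integrable_finsetSum _ fun t _ =>
      (integrable_exp_mul_sum_abs_gaussianPi _).const_mul _)
    (Filter.Eventually.of_forall fun ξ x _ => ?_)).2
  · refine Continuous.aestronglyMeasurable (continuous_finsetSum _ fun t _ => ?_)
    exact ((continuous_expSoftMaxGrad t).comp (continuous_mulVec _)).mul
      ((continuous_apply t).comp (continuous_mulVec _))
  · rw [Real.norm_eq_abs]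
    refine (Finset.abs_sum_le_sum_abs _ _).trans (Finset.sum_le_sum fun t _ => ?_)
    refine abs_grad_mul_le hβ hq (hbd _ _ (Real.abs_cos_le_one x) (Real.abs_sin_le_one x)) ξ
      (by positivity) (abs_mulVec_le (hbd _ _ ?_ (Real.abs_cos_le_one x)) ξ t) t
    rw [abs_neg]; exact Real.abs_sin_le_one x
  · refine hasDerivAt_expSoftMax (x := fun φ => (Real.cos φ • a + Real.sin φ • b) *ᵥ ξ) fun t => ?_
    simp only [Matrix.add_mulVec, Matrix.smul_mulVec, Pi.add_apply, Pi.smul_apply, smul_eq_mul]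
    exact ((Real.hasDerivAt_cos x).mul_const _).add ((Real.hasDerivAt_sin x).mul_const _)

/-- A Gaussian comparison inequality of Slepian type for the soft maximum: the process `b *ᵥ ξ`
plus an independent standard normal variable has the same variances as `a *ᵥ ξ`, and larger
covariances. -/
theorem integral_expSoftMax_comparison (hβ : 0 ≤ β) (hq : 0 ≤ q) (hq1 : q ≤ 1)
    {a b : Matrix T κ ℝ} (hab : a * bᵀ = 0) (hdiag : ∀ t, (b * bᵀ) t t + 1 = (a * aᵀ) t t)
    (hle : ∀ t s, (a * aᵀ) t s ≤ (b * bᵀ) t s + 1) :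
    Real.exp ((q * β) ^ 2 / 2) * ∫ ξ, expSoftMax β q (b *ᵥ ξ) ∂gaussianPi κ
      ≤ ∫ ξ, expSoftMax β q (a *ᵥ ξ) ∂gaussianPi κ := by
  classical
  have hba : b * aᵀ = 0 := by simpa using congrArg Matrix.transpose hab
  set c : ℝ → Matrix T κ ℝ := fun φ => Real.cos φ • a + Real.sin φ • b with hc
  set ψ : ℝ → ℝ := fun φ => ∫ ξ, expSoftMax β q (c φ *ᵥ ξ) ∂gaussianPi κ with hψ
  set D : ℝ → ℝ := fun φ => ∫ ξ, ∑ t, ∑ s, ((-Real.sin φ • a + Real.cos φ • b) * (c φ)ᵀ) t s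
        * expSoftMaxHess β q (c φ *ᵥ ξ) t s ∂gaussianPi κ with hD
  have hd : ∀ φ, HasDerivAt ψ (D φ) φ := fun φ => hasDerivAt_integral_rotation hβ hq a b φ
  have hcov : ∀ φ t s, ((-Real.sin φ • a + Real.cos φ • b) * (c φ)ᵀ) t s
      = Real.sin φ * Real.cos φ * ((b * bᵀ) t s - (a * aᵀ) t s) := by
    intro φ t s
    simp only [hc, Matrix.transpose_add, Matrix.transpose_smul, Matrix.add_mul, Matrix.mul_add,
      Matrix.smul_mul, Matrix.mul_smul, hab, hba, smul_zero, Matrix.add_apply, Matrix.smul_apply,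
      Matrix.zero_apply, smul_eq_mul]
    ring
  have hle' : ∀ φ, 0 ≤ Real.sin φ * Real.cos φ →
      D φ ≤ -(Real.sin φ * Real.cos φ * (q * β) ^ 2) * ψ φ := by
    intro φ hφ
    rw [hψ, hD]
    simp only
    rw [← integral_const_mul]
    refine integral_mono (integrable_finsetSum _ fun t _ => integrable_finsetSum _ fun s _ =>
      (integrable_expSoftMaxHess_mulVec hβ hq _ t s).const_mul _)
      ((integrable_expSoftMax_mulVec hβ hq _).const_mul _) fun ξ => ?_
    simp only
    rw [neg_mul, mul_assoc, ← sum_sum_expSoftMaxHess, ← mul_neg, ← Finset.sum_neg_distrib,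
      Finset.mul_sum]
    refine Finset.sum_le_sum fun t _ => ?_
    rw [← Finset.sum_neg_distrib, Finset.mul_sum]
    refine Finset.sum_le_sum fun s _ => ?_
    rw [hcov, mul_assoc]
    refine mul_le_mul_of_nonneg_left ?_ hφ
    -- The covariance difference is `-1` on the diagonal and at least `-1` off it, where the Hessian
    -- is nonpositive; so replacing it by `-1` everywhere only increases the sum.
    rcases eq_or_ne t s with rfl | hts
    · have := hdiag t
      rw [show (b * bᵀ) t t - (a * aᵀ) t t = -1 by linarith]; linarith
    · nlinarith [hle t s, expSoftMaxHess_nonpos_of_ne hq hq1 (c φ *ᵥ ξ) (β := β) hts]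
  -- Integrating factor for `ψ' ≤ -(q β)² sin φ cos φ ψ`; its values at `0` and `π/2` are `1` and
  -- `exp ((q β)²/2)`.
  have hE : ∀ φ, HasDerivAt (fun φ => Real.exp ((q * β) ^ 2 / 2 * Real.sin φ ^ 2) * ψ φ)
      (Real.exp ((q * β) ^ 2 / 2 * Real.sin φ ^ 2)
        * (D φ + Real.sin φ * Real.cos φ * (q * β) ^ 2 * ψ φ)) φ := by
    intro φ
    refine (((((Real.hasDerivAt_sin φ).fun_pow 2).const_mul _).exp).mul (hd φ)).congr_deriv ?_
    push_cast
    ring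
  have hanti : AntitoneOn (fun φ => Real.exp ((q * β) ^ 2 / 2 * Real.sin φ ^ 2) * ψ φ)
      (Set.Icc 0 (Real.pi / 2)) := by
    refine antitoneOn_of_deriv_nonpos (convex_Icc _ _)
      (fun φ _ => (hE φ).continuousAt.continuousWithinAt)
      (fun φ _ => (hE φ).differentiableAt.differentiableWithinAt) fun φ hφ => ?_
    rw [interior_Icc] at hφ
    rw [(hE φ).deriv]
    have h1 := Real.sin_nonneg_of_nonneg_of_le_pi hφ.1.le (by linarith [hφ.2, Real.pi_pos])
    have h2 := Real.cos_nonneg_of_neg_pi_div_two_le_of_le (x := φ)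
      (by linarith [hφ.1, Real.pi_pos]) hφ.2.le
    have := hle' φ (mul_nonneg h1 h2)
    exact mul_nonpos_of_nonneg_of_nonpos (Real.exp_pos _).le (by linarith)
  have h := hanti (Set.left_mem_Icc.2 (by positivity)) (Set.right_mem_Icc.2 (by positivity))
    (by positivity)
  simpa [hψ, hc] using h

end Interpolation

/-! ### Gaussian bilinear forms on finitely many pairs of unit vectors. -/

section BilinearForms

open Matrix

/-- Forgetting coordinates maps a standard Gaussian vector to a standard Gaussian vector. -/
theorem measurePreserving_comp_inl_gaussianPi (κ ι : Type*) [Fintype κ] [Fintype ι] :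
    MeasurePreserving (fun (ξ : κ ⊕ ι → ℝ) (k : κ) => ξ (Sum.inl k))
      (gaussianPi (κ ⊕ ι)) (gaussianPi κ) := by
  have hm : Measurable (fun (ξ : κ ⊕ ι → ℝ) (k : κ) => ξ (Sum.inl k)) := by fun_prop
  refine ⟨hm, (Measure.pi_eq fun s hs => ?_).symm⟩
  rw [Measure.map_apply hm (MeasurableSet.univ_pi hs)]
  have : (fun (ξ : κ ⊕ ι → ℝ) (k : κ) => ξ (Sum.inl k)) ⁻¹' Set.univ.pi s
      = Set.univ.pi (Sum.elim s fun _ => Set.univ) := by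
    ext ξ; simp [Set.mem_pi]
  rw [this, Measure.pi_pi, Fintype.prod_sum_type]
  simp

variable {T I J : Type*} [Fintype I] [Fintype J]

/-- Coefficients of the process `∑ i, ∑ j, v i * u j * ξ (i, j)`. -/
def bilinCoeff (v : T → I → ℝ) (u : T → J → ℝ) : Matrix T ((I × J) ⊕ (I ⊕ J)) ℝ :=
  fun t => Sum.elim (fun p => v t p.1 * u t p.2) fun _ => 0

/-- Coefficients of the process `∑ i, v i * g i + ∑ j, u j * h j`. -/
def splitCoeff (v : T → I → ℝ) (u : T → J → ℝ) : Matrix T ((I × J) ⊕ (I ⊕ J)) ℝ :=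
  fun t => Sum.elim (fun _ => 0) (Sum.elim (v t) (u t))

variable {v : T → I → ℝ} {u : T → J → ℝ}

theorem bilinCoeff_mulVec (ξ : (I × J) ⊕ (I ⊕ J) → ℝ) (t : T) :
    (bilinCoeff v u *ᵥ ξ) t = ∑ i, ∑ j, v t i * u t j * ξ (Sum.inl (i, j)) := by
  simp [Matrix.mulVec, dotProduct, bilinCoeff, Fintype.sum_sum_type, Fintype.sum_prod_type]

theorem splitCoeff_mulVec (ξ : (I × J) ⊕ (I ⊕ J) → ℝ) (t : T) :
    (splitCoeff v u *ᵥ ξ) t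
      = ∑ i, v t i * ξ (Sum.inr (Sum.inl i)) + ∑ j, u t j * ξ (Sum.inr (Sum.inr j)) := by
  simp [Matrix.mulVec, dotProduct, splitCoeff, Fintype.sum_sum_type]

/-- The two processes use disjoint blocks of coordinates, hence are independent. -/
theorem splitCoeff_mul_bilinCoeff_transpose :
    splitCoeff v u * (bilinCoeff v u)ᵀ = 0 := by
  ext t s
  simp [Matrix.mul_apply, splitCoeff, bilinCoeff, Fintype.sum_sum_type]

theorem splitCoeff_mul_transpose (t s : T) :
    (splitCoeff v u * (splitCoeff v u)ᵀ) t s = ∑ i, v t i * v s i + ∑ j, u t j * u s j := by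
  simp [Matrix.mul_apply, splitCoeff, Fintype.sum_sum_type]

theorem bilinCoeff_mul_transpose (t s : T) :
    (bilinCoeff v u * (bilinCoeff v u)ᵀ) t s = (∑ i, v t i * v s i) * ∑ j, u t j * u s j := by
  simp only [Matrix.mul_apply, bilinCoeff, Matrix.transpose_apply, Fintype.sum_sum_type,
    Sum.elim_inl, Sum.elim_inr, mul_zero, Finset.sum_const_zero, add_zero,
    Fintype.sum_prod_type, Finset.sum_mul_sum]
  exact Finset.sum_congr rfl fun i _ => Finset.sum_congr rfl fun j _ => by ring

theorem sum_mul_le_one_of_unit {x y : I → ℝ} (hx : ∑ i, x i ^ 2 = 1) (hy : ∑ i, y i ^ 2 = 1) :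
    ∑ i, x i * y i ≤ 1 := by
  calc ∑ i, x i * y i ≤ ∑ i, (x i ^ 2 / 2 + y i ^ 2 / 2) :=
        Finset.sum_le_sum fun i _ => by nlinarith [sq_nonneg (x i - y i)]
    _ = 1 := by rw [Finset.sum_add_distrib, ← Finset.sum_div, ← Finset.sum_div, hx, hy]; norm_num

/-- Weighted AM-GM replaces the norm of `g` by a quadratic, whose exponential moment factors over
coordinates. -/
theorem sum_mul_le_of_unit {x : I → ℝ} (hx : ∑ i, x i ^ 2 = 1) (g : I → ℝ) {c : ℝ} (hc : 0 < c) :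
    ∑ i, x i * g i ≤ c / 2 + ∑ i, 1 / (2 * c) * g i ^ 2 := by
  calc ∑ i, x i * g i ≤ ∑ i, (c / 2 * x i ^ 2 + 1 / (2 * c) * g i ^ 2) := by
        refine Finset.sum_le_sum fun i _ => ?_
        have : c / 2 * x i ^ 2 + 1 / (2 * c) * g i ^ 2 - x i * g i
            = (c * x i - g i) ^ 2 / (2 * c) := by field_simp; ring
        have h2 : 0 ≤ (c * x i - g i) ^ 2 / (2 * c) := by positivity
        linarith
    _ = _ := by rw [Finset.sum_add_distrib, ← Finset.mul_sum, hx, mul_one]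

section

variable [Fintype T] [Nonempty T] [Nonempty I] [Nonempty J]

/-- The exponential moment of `‖g‖ + ‖h‖` controls that of the decoupled process. -/
theorem integral_expSoftMax_splitCoeff_le (hv : ∀ t, ∑ i, v t i ^ 2 = 1)
    (hu : ∀ t, ∑ j, u t j ^ 2 = 1) {β q : ℝ} (hβ : 0 ≤ β) (hq : 0 ≤ q) :
    ∫ ξ, expSoftMax β q (splitCoeff v u *ᵥ ξ) ∂gaussianPi ((I × J) ⊕ (I ⊕ J))
      ≤ (Fintype.card T : ℝ) ^ q * Real.exp ((q * β) ^ 2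
        + q * β * (√(Fintype.card I : ℝ) + √(Fintype.card J : ℝ))) := by
  set θ := q * β with hθ'
  have hθ : 0 ≤ θ := mul_nonneg hq hβ
  set r := √(Fintype.card I : ℝ) with hr'
  set s := √(Fintype.card J : ℝ) with hs'
  have hr : 0 < r := Real.sqrt_pos.2 (by exact_mod_cast Fintype.card_pos)
  have hs : 0 < s := Real.sqrt_pos.2 (by exact_mod_cast Fintype.card_pos)
  have hr2 : (Fintype.card I : ℝ) = r * r := (Real.mul_self_sqrt (by positivity)).symm
  have hs2 : (Fintype.card J : ℝ) = s * s := (Real.mul_self_sqrt (by positivity)).symm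
  -- These weights come from `sum_mul_le_of_unit` with `c = θ + r` and `c = θ + s`, multiplied by
  -- `θ`; the choice keeps them below `1/2`.
  set w : (I × J) ⊕ (I ⊕ J) → ℝ := Sum.elim (fun _ => 0)
    (Sum.elim (fun _ => θ / (2 * (θ + r))) fun _ => θ / (2 * (θ + s))) with hw
  have hw2 : ∀ k, w k < 1 / 2 := by
    have aux : ∀ x : ℝ, 0 < x → θ / (2 * (θ + x)) < 1 / 2 := fun x hx => by
      rw [div_lt_iff₀ (by positivity)]; linarith
    rintro (_ | _ | _)
    · simp [hw]
    · exact aux r hr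
    · exact aux s hs
  have hpt : ∀ ξ, expSoftMax β q (splitCoeff v u *ᵥ ξ) ≤ (Fintype.card T : ℝ) ^ q *
      (Real.exp (θ * ((θ + r) / 2 + (θ + s) / 2)) * ∏ k, Real.exp (w k * ξ k ^ 2)) := by
    intro ξ
    have h := expSoftMax_le (T := T) hβ hq (x := splitCoeff v u *ᵥ ξ)
      (M := ((θ + r) / 2 + ∑ i, 1 / (2 * (θ + r)) * ξ (Sum.inr (Sum.inl i)) ^ 2)
        + ((θ + s) / 2 + ∑ j, 1 / (2 * (θ + s)) * ξ (Sum.inr (Sum.inr j)) ^ 2)) fun t => by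
        rw [splitCoeff_mulVec]
        exact add_le_add (sum_mul_le_of_unit (hv t) _ (by positivity))
          (sum_mul_le_of_unit (hu t) _ (by positivity))
    refine h.trans_eq ?_
    rw [← Real.exp_sum, ← Real.exp_add]
    congr 2
    simp only [hw, Fintype.sum_sum_type, Sum.elim_inl, Sum.elim_inr, zero_mul,
      Finset.sum_const_zero, zero_add, ← Finset.mul_sum]
    ring
  have hI : Integrable (fun ξ : (I × J) ⊕ (I ⊕ J) → ℝ => ∏ k, Real.exp (w k * ξ k ^ 2))
      (gaussianPi _) :=
    Integrable.fintype_prod (f := fun k (y : ℝ) => Real.exp (w k * y ^ 2))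
      fun k => integrable_exp_mul_sq_gaussianReal (hw2 k)
  refine (integral_mono (integrable_expSoftMax_mulVec hβ hq _)
    ((hI.const_mul _).const_mul _) hpt).trans ?_
  rw [integral_const_mul, integral_const_mul]
  refine mul_le_mul_of_nonneg_left ?_ (by positivity)
  rw [integral_fintype_prod_eq_prod (fun k (y : ℝ) => Real.exp (w k * y ^ 2))]
  -- There are `r²` factors of at most `exp (θ / (2 r))`, and `s²` of at most `exp (θ / (2 s))`.
  have hprod : ∏ k, ∫ y, Real.exp (w k * y ^ 2) ∂gaussianReal 0 1
      ≤ Real.exp (θ * r / 2 + θ * s / 2) := by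
    simp only [hw, Fintype.prod_sum_type, Sum.elim_inl, Sum.elim_inr, zero_mul, Real.exp_zero,
      integral_const, probReal_univ, smul_eq_mul, mul_one, Finset.prod_const, Finset.card_univ,
      one_pow, one_mul]
    have hi := pow_le_pow_left₀ (integral_nonneg fun y => (Real.exp_pos _).le)
      (integral_exp_mul_sq_gaussianReal_le hθ hr) (Fintype.card I)
    have hj := pow_le_pow_left₀ (integral_nonneg fun y => (Real.exp_pos _).le)
      (integral_exp_mul_sq_gaussianReal_le hθ hs) (Fintype.card J)
    refine (mul_le_mul hi hj (pow_nonneg (integral_nonneg fun y => (Real.exp_pos _).le) _)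
      (by positivity)).trans_eq ?_
    rw [← Real.exp_nat_mul, ← Real.exp_nat_mul, ← Real.exp_add, hr2, hs2]
    congr 1
    field_simp
  refine (mul_le_mul_of_nonneg_left hprod (Real.exp_pos _).le).trans_eq ?_
  rw [← Real.exp_add]
  congr 1
  ring

theorem integral_expSoftMax_bilinCoeff_le (hv : ∀ t, ∑ i, v t i ^ 2 = 1)
    (hu : ∀ t, ∑ j, u t j ^ 2 = 1) {β q : ℝ} (hβ : 0 ≤ β) (hq : 0 ≤ q) (hq1 : q ≤ 1) :
    ∫ ξ, expSoftMax β q (bilinCoeff v u *ᵥ ξ) ∂gaussianPi ((I × J) ⊕ (I ⊕ J))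
      ≤ (Fintype.card T : ℝ) ^ q * Real.exp ((q * β) ^ 2 / 2
        + q * β * (√(Fintype.card I : ℝ) + √(Fintype.card J : ℝ))) := by
  have h := (integral_expSoftMax_comparison (a := splitCoeff v u) (b := bilinCoeff v u) hβ hq hq1
    splitCoeff_mul_bilinCoeff_transpose (fun t => ?_) (fun t s => ?_)).trans
    (integral_expSoftMax_splitCoeff_le hv hu hβ hq)
  · rw [← le_div_iff₀' (Real.exp_pos _), mul_div_assoc, ← Real.exp_sub] at h
    refine h.trans_eq ?_
    congr 2
    ring
  · rw [bilinCoeff_mul_transpose, splitCoeff_mul_transpose]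
    simp only [← sq, hv, hu]
    norm_num
  · rw [bilinCoeff_mul_transpose, splitCoeff_mul_transpose]
    -- With `x`, `y` the two inner products, this is `(1 - x)(1 - y) ≥ 0`.
    nlinarith [sum_mul_le_one_of_unit (hv t) (hv s), sum_mul_le_one_of_unit (hu t) (hu s)]

/-- Tail bound for the maximum of finitely many values of a Gaussian bilinear form on unit
vectors. -/
theorem gaussianPi_exists_lt_bilin_le (hv : ∀ t, ∑ i, v t i ^ 2 = 1)
    (hu : ∀ t, ∑ j, u t j ^ 2 = 1) {θ : ℝ} (hθ : 0 ≤ θ) (R : ℝ) :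
    (gaussianPi (I × J)).real {x | ∃ t, R < ∑ i, ∑ j, v t i * u t j * x (i, j)}
      ≤ Real.exp (θ ^ 2 / 2 + θ * (√(Fintype.card I : ℝ) + √(Fintype.card J : ℝ)) - θ * R) := by
  set B := Real.exp (θ ^ 2 / 2 + θ * (√(Fintype.card I : ℝ) + √(Fintype.card J : ℝ)) - θ * R)
    with hB
  have hmeas : MeasurableSet {x : I × J → ℝ | ∃ t, R < ∑ i, ∑ j, v t i * u t j * x (i, j)} := by
    rw [Set.ofPred_exists]
    exact MeasurableSet.iUnion fun t => measurableSet_lt measurable_const (by fun_prop)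
  rw [← (measurePreserving_comp_inl_gaussianPi (I × J) (I ⊕ J)).measureReal_preimage
    hmeas.nullMeasurableSet]
  have hq : ∀ q : ℝ, 0 < q → q ≤ 1 → (gaussianPi ((I × J) ⊕ (I ⊕ J))).real
      ((fun ξ k => ξ (Sum.inl k)) ⁻¹'
        {x : I × J → ℝ | ∃ t, R < ∑ i, ∑ j, v t i * u t j * x (i, j)})
      ≤ (Fintype.card T : ℝ) ^ q * B := by
    intro q hq hq1
    have hqθ : q * (θ / q) = θ := by field_simp
    have hβ : 0 ≤ θ / q := by positivity
    have hmarkov := mul_meas_ge_le_integral_of_nonneg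
      (Filter.Eventually.of_forall fun ξ => (expSoftMax_pos (β := θ / q) (q := q) _).le)
      (integrable_expSoftMax_mulVec hβ hq.le (bilinCoeff v u)) (Real.exp (θ * R))
    have hE := integral_expSoftMax_bilinCoeff_le hv hu hβ hq.le hq1
    rw [hqθ] at hE
    have hsub : (gaussianPi ((I × J) ⊕ (I ⊕ J))).real ((fun ξ k => ξ (Sum.inl k)) ⁻¹'
        {x : I × J → ℝ | ∃ t, R < ∑ i, ∑ j, v t i * u t j * x (i, j)})
        ≤ (gaussianPi ((I × J) ⊕ (I ⊕ J))).real
          {ξ | Real.exp (θ * R) ≤ expSoftMax (θ / q) q (bilinCoeff v u *ᵥ ξ)} := by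
      refine measureReal_mono ?_
      rintro ξ ⟨t, ht⟩
      refine le_trans ?_ (exp_le_expSoftMax hq.le _ t)
      rw [hqθ, bilinCoeff_mulVec]
      exact Real.exp_le_exp.2 (mul_le_mul_of_nonneg_left ht.le hθ)
    refine hsub.trans ?_
    have h := hmarkov.trans hE
    rw [← le_div_iff₀' (Real.exp_pos _), mul_div_assoc, ← Real.exp_sub] at h
    exact h
  -- Letting `q → 0` with `q β = θ` fixed sends the cardinality factor to `1`.
  have hcont : ContinuousAt (fun q : ℝ => (Fintype.card T : ℝ) ^ q * B) 0 :=
    (Real.continuousAt_const_rpow (by exact_mod_cast Fintype.card_ne_zero)).mul continuousAt_const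
  have hlim := hcont.tendsto.mono_left (nhdsWithin_le_nhds (s := Set.Ioi 0))
  simp only [Real.rpow_zero, one_mul] at hlim
  refine ge_of_tendsto hlim ?_
  filter_upwards [Ioc_mem_nhdsGT (zero_lt_one (α := ℝ))] with q h using hq q h.1 h.2

end

end BilinearForms

/-! ### From finite sets to the largest singular value. -/

section SingularValue

variable {n m : ℕ}

/-- The largest singular value is attained as a value of the bilinear form on unit vectors. -/
theorem exists_unit_lt_inner_of_lt_sMax (hm : 0 < m) {M : Matrix (Fin n) (Fin m) ℝ} {R : ℝ}
    (hR : 0 ≤ R) (h : R < sMax M) :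
    ∃ (v : Metric.sphere (0 : EuclideanSpace ℝ (Fin n)) 1)
      (u : Metric.sphere (0 : EuclideanSpace ℝ (Fin m)) 1),
      R < inner ℝ (v : EuclideanSpace ℝ (Fin n)) (Matrix.toEuclideanLin M u) := by
  set L := Matrix.toEuclideanLin M with hL
  set σ := sMax M with hσ
  have hσ0 : 0 < σ := hR.trans_lt h
  obtain ⟨x, hx⟩ := (L.hasEigenvalue_adjoint_comp_self_sq_singularValues
    (n := 0) (by simpa using hm)).exists_hasEigenvector
  have hx0 : 0 < ‖x‖ := norm_pos_iff.2 hx.2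
  have hLx : ‖L x‖ = σ * ‖x‖ := by
    have h1 : inner ℝ (L x) (L x) = σ ^ 2 * inner ℝ x x := by
      have := hx.apply_eq_smul
      rw [← LinearMap.adjoint_inner_left, ← LinearMap.comp_apply, this, inner_smul_left]
      simp [hσ, sMax, hL]
    rw [real_inner_self_eq_norm_sq, real_inner_self_eq_norm_sq, ← mul_pow] at h1
    exact (sq_eq_sq₀ (norm_nonneg _) (by positivity)).1 h1
  -- The vectors are a normalized top right singular vector `x` and its normalized image.
  refine ⟨⟨(σ * ‖x‖)⁻¹ • L x, ?_⟩, ⟨‖x‖⁻¹ • x, ?_⟩, ?_⟩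
  · rw [mem_sphere_zero_iff_norm, norm_smul, hLx, norm_inv, Real.norm_of_nonneg (by positivity),
      inv_mul_cancel₀ (by positivity)]
  · rw [mem_sphere_zero_iff_norm, norm_smul, norm_inv, norm_norm, inv_mul_cancel₀ hx0.ne']
  · simp only [map_smul, inner_smul_left, inner_smul_right, real_inner_self_eq_norm_sq, hLx]
    refine h.trans_eq ?_
    simp
    field_simp

theorem inner_toEuclideanLin_eq_sum (M : Matrix (Fin n) (Fin m) ℝ) (v : EuclideanSpace ℝ (Fin n))
    (u : EuclideanSpace ℝ (Fin m)) :
    inner ℝ v (Matrix.toEuclideanLin M u) = ∑ i, ∑ j, v i * u j * M i j := by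
  rw [PiLp.inner_apply]
  refine Finset.sum_congr rfl fun i _ => ?_
  simp only [Matrix.toLpLin_apply, Matrix.mulVec, dotProduct, RCLike.inner_apply, conj_trivial,
    Finset.sum_mul]
  exact Finset.sum_congr rfl fun j _ => by ring

theorem sum_sq_coord_of_mem_sphere {ι : Type*} [Fintype ι]
    (v : Metric.sphere (0 : EuclideanSpace ℝ ι) 1) :
    ∑ i, (v : EuclideanSpace ℝ ι) i ^ 2 = 1 := by
  rw [← EuclideanSpace.real_norm_sq_eq, mem_sphere_zero_iff_norm.1 v.2, one_pow]

/-- Chernoff bound for the largest singular value of a Gaussian matrix. -/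
theorem measureReal_lt_sMax_le {Ω : Type*} [MeasurableSpace Ω] (μ : Measure Ω)
    [IsProbabilityMeasure μ] (hn : 0 < n) (hm : 0 < m) (A : Ω → Matrix (Fin n) (Fin m) ℝ)
    (hA : IsGaussianMatrix μ A) {θ R : ℝ} (hθ : 0 ≤ θ) (hR : 0 ≤ R) :
    μ.real {ω | R < sMax (A ω)} ≤ Real.exp (θ ^ 2 / 2 + θ * (√(n : ℝ) + √(m : ℝ)) - θ * R) := by
  have : Nonempty (Fin n) := ⟨⟨0, hn⟩⟩
  have : Nonempty (Fin m) := ⟨⟨0, hm⟩⟩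
  have : Nonempty (Metric.sphere (0 : EuclideanSpace ℝ (Fin n)) 1) :=
    (NormedSpace.sphere_nonempty.2 zero_le_one).to_subtype
  have : Nonempty (Metric.sphere (0 : EuclideanSpace ℝ (Fin m)) 1) :=
    (NormedSpace.sphere_nonempty.2 zero_le_one).to_subtype
  have hmeas : ∀ p : Fin n × Fin m, AEMeasurable (fun ω => A ω p.1 p.2) μ :=
    fun p => (hA.hasLaw p.1 p.2).aemeasurable
  have hlaw : μ.map (fun ω (p : Fin n × Fin m) => A ω p.1 p.2) = gaussianPi (Fin n × Fin m) := by
    rw [(iIndepFun_iff_map_fun_eq_pi_map hmeas).1 hA.indep]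
    congr 1
    funext p
    exact (hA.hasLaw p.1 p.2).map_eq
  set d := TopologicalSpace.denseSeq (Metric.sphere (0 : EuclideanSpace ℝ (Fin n)) 1
    × Metric.sphere (0 : EuclideanSpace ℝ (Fin m)) 1) with hd
  set E : ℕ → Set (Fin n × Fin m → ℝ) := fun k => {x | ∃ t : Fin (k + 1), R < ∑ i, ∑ j,
    ((d t).1 : EuclideanSpace ℝ (Fin n)) i * ((d t).2 : EuclideanSpace ℝ (Fin m)) j * x (i, j)}
    with hE
  have hEm : ∀ k, MeasurableSet (E k) := fun k => by
    rw [hE]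
    simp only [Set.ofPred_exists]
    exact MeasurableSet.iUnion fun t => measurableSet_lt measurable_const (by fun_prop)
  have hmono : Monotone E := fun k l hkl x ⟨t, ht⟩ => ⟨t.castLE (by omega), ht⟩
  have hsub : {ω | R < sMax (A ω)} ⊆ (fun ω (p : Fin n × Fin m) => A ω p.1 p.2) ⁻¹' ⋃ k, E k := by
    intro ω hω
    obtain ⟨v, u, hvu⟩ := exists_unit_lt_inner_of_lt_sMax hm hR hω
    -- Strictness of `R < ...` makes the condition open, so some pair of the dense sequence
    -- satisfies it.
    have hopen : IsOpen {p : Metric.sphere (0 : EuclideanSpace ℝ (Fin n)) 1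
        × Metric.sphere (0 : EuclideanSpace ℝ (Fin m)) 1 |
          R < inner ℝ (p.1 : EuclideanSpace ℝ (Fin n)) (Matrix.toEuclideanLin (A ω) p.2)} := by
      have hc : Continuous (Matrix.toEuclideanLin (A ω)) :=
        LinearMap.continuous_of_finiteDimensional _
      exact isOpen_lt continuous_const (by fun_prop)
    obtain ⟨k, hk⟩ := (TopologicalSpace.denseRange_denseSeq _).exists_mem_open hopen ⟨(v, u), hvu⟩
    rw [Set.mem_preimage, Set.mem_iUnion]
    refine ⟨k, Fin.last k, ?_⟩
    rw [Set.mem_ofPred_eq, inner_toEuclideanLin_eq_sum] at hk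
    exact hk
  have hmap : μ {ω | R < sMax (A ω)} ≤ gaussianPi (Fin n × Fin m) (⋃ k, E k) := by
    rw [← hlaw, Measure.map_apply_of_aemeasurable (aemeasurable_pi_lambda _ hmeas)
      (MeasurableSet.iUnion hEm)]
    exact measure_mono hsub
  refine ENNReal.toReal_le_of_le_ofReal (Real.exp_pos _).le (hmap.trans ?_)
  rw [hmono.measure_iUnion]
  refine iSup_le fun k => ?_
  rw [ENNReal.le_ofReal_iff_toReal_le (measure_ne_top _ _) (Real.exp_pos _).le]
  have := gaussianPi_exists_lt_bilin_le (T := Fin (k + 1)) (I := Fin n) (J := Fin m)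
    (v := fun t => ((d t).1 : EuclideanSpace ℝ (Fin n)))
    (u := fun t => ((d t).2 : EuclideanSpace ℝ (Fin m)))
    (fun t => sum_sq_coord_of_mem_sphere _) (fun t => sum_sq_coord_of_mem_sphere _) hθ R
  rw [Fintype.card_fin, Fintype.card_fin] at this
  exact this

end SingularValue

/-! ### The explicit threshold. -/

theorem rBound_mul_sqrt {n m : ℕ} (hm : 0 < m) {α : ℝ} (hα : 0 ≤ α) :
    rBound α (redundancyRate n m) * √(m : ℝ) = √(n : ℝ) + √(m : ℝ) + √(2 * α * m) := by
  have hm' : (0 : ℝ) < m := by exact_mod_cast hm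
  have h : (1 - redundancyRate n m) ^ (-(1 / 2) : ℝ) * √(m : ℝ) = √(n : ℝ) := by
    rw [redundancyRate, sub_sub_cancel, Real.rpow_neg (by positivity), ← Real.sqrt_eq_rpow,
      ← Real.sqrt_inv, ← Real.sqrt_mul (by positivity), inv_div, div_mul_cancel₀ _ hm'.ne']
  rw [rBound, add_mul, add_mul, h, one_mul, Real.sqrt_mul (by positivity) (m : ℝ)]

theorem theorem4p2 {Ω : Type*} [MeasurableSpace Ω] (μ : Measure Ω) [IsProbabilityMeasure μ]
    {n m : ℕ} (hm : 0 < m) (hmn : m < n)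
    (A : Ω → Matrix (Fin n) (Fin m) ℝ) (hA : IsGaussianMatrix μ A)
    {α : ℝ} (hα : 0 < α) :
    μ.real {ω | rBound α (redundancyRate n m) * √(m : ℝ) ≤ sMax (A ω)}
      ≤ Real.exp (-(α * (m : ℝ))) := by
  have hm' : (0 : ℝ) < m := by exact_mod_cast hm
  rw [rBound_mul_sqrt hm hα.le]
  set θ := √(2 * α * m) with hθ
  have hθ2 : θ ^ 2 = 2 * α * m := Real.sq_sqrt (by positivity)
  have hθ0 : 0 < θ := Real.sqrt_pos.2 (by positivity)
  set R₀ := √(n : ℝ) + √(m : ℝ) + θ with hR₀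
  have hR₀0 : 0 < R₀ := by positivity
  have hcont : Continuous fun R : ℝ =>
    Real.exp (θ ^ 2 / 2 + θ * (√(n : ℝ) + √(m : ℝ)) - θ * R) := by fun_prop
  -- The Chernoff bound concerns strict exceedance, so the event `R₀ ≤ s_max` is bounded through `R
  -- < R₀` and then `R → R₀`.
  have hlim := (hcont.tendsto R₀).mono_left (nhdsWithin_le_nhds (s := Set.Iio R₀))
  have hval : θ ^ 2 / 2 + θ * (√(n : ℝ) + √(m : ℝ)) - θ * R₀ = -(α * m) := by
    rw [hR₀]; linear_combination (-1 / 2) * hθ2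
  rw [hval] at hlim
  refine ge_of_tendsto hlim ?_
  filter_upwards [Ico_mem_nhdsLT hR₀0] with R hR
  exact (measureReal_mono fun ω hω => lt_of_lt_of_le hR.2 hω).trans
    (measureReal_lt_sMax_le μ (hm.trans hmn) hm A hA hθ0.le hR.1)
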